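/- Let $\Delta$ be an abstract simplicial complex on the ground set $[n]=\{1,\dots,n\}$ (with $\emptyset\in\Delta$), let $I_\Delta=\langle \mathbf{x}^{\mathbf{a}} : \operatorname{supp}(\mathbf{a})\notin\Delta\rangle\subset\mathbb{R}[\mathbf{x}]=\mathbb{R}[x_1,\dots,x_n]$ be its nonface ideal and $\mathbb{R}[\Delta]=\mathbb{R}[\mathbf{x}]/I_\Delta$ its Stanley–Reisner ring. For a polynomial $p$ let $p^\vee=p(\mathrm{d}/\mathrm{d}\mathbf{x})$ be the associated constant-coefficient differential operator on $\mathbb{R}[\mathbf{x}]$. For a finite sequence $\Theta=(\theta_1,\dots,\theta_\ell)$ of linear forms, let $$\widetilde{\mathrm S}(\Delta;\Theta^\vee)=\{q\in\mathbb{R}[\mathbf{x}] : p^\vee q=0 \text{ for all } p\in I_\Delta,\ \theta_j^\vee q=0 \text{ for all } j\},$$ with degree-$i$ homogeneous part $\widetilde{\mathrm S}_i(\Delta;\Theta^\vee)$ (so $\widetilde{\mathrm S}_{-1}=0$). The sequence $\Theta$ is called regular (regular up to degree $k$) if for every $1\le j\le \ell$ and every $i\ge 0$ (every $0\le i\le k$)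 the map $\theta_j^\vee:\widetilde{\mathrm S}_{i+1}(\Delta;(\theta_1,\dots,\theta_{j-1})^\vee)\to\widetilde{\mathrm S}_{i}(\Delta;(\theta_1,\dots,\theta_{j-1})^\vee)$ is surjective. It is a linear system of parameters if $\ell=\dim\mathbb{R}[\Delta]$ and $\dim \mathbb{R}[\Delta]/\Theta\mathbb{R}[\Delta]=0$ (Krull dimensions). The depth of $\Delta$ is the largest length of a regular sequence of linear forms, and $\Delta$ is Cohen–Macaulay if its depth equals $\dim\mathbb{R}[\Delta]$. A missing face of $\Delta$ is an inclusion-minimal nonface on the vertex set of $\Delta$; the dimension of $\sigma$ is $|\sigma|-1$. Let $V_\Delta\in\mathbb{R}^{\ell\times n}$ be a coordinatization of $\Delta$, that is, a map from $[n]$ to $\mathbb{R}^\ell$ sending $i$ to the $i$-th column (no properness is assumed), let $V_\Delta\nabla$ be the sequence of the $\ell$ linear differentials given by the rows of $V_\Delta$, and let $\mathrm S(\Delta)=\widetilde{\mathrm S}(\Delta;\Theta^\vee)$ for $\Theta=V_\Delta\mathbf{x}$. Let $\omega=\sum_i w_i\,\mathrm{d}/\mathrm{d}x_i$ be a linear differential.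 Assume that, for some integer $k\ge 0$, (A) $\Delta$ is toric $k$-chordal with respect to $V_\Delta$ and $\omega$, that is, $\omega:\mathrm S_{k+1}(\Delta)\to\mathrm S_k(\Delta)$ is surjective and $\omega:\mathrm S_k(\Delta)\to\mathrm S_{k-1}(\Delta)$ is injective; (B) $\Delta$ has no missing faces of dimension $>k$; (C) the sequence $(V_\Delta\nabla,\omega)$ of length $\ell+1$ is regular up to degree $k$. Then $(V_\Delta\nabla,\omega)$ is a regular sequence (in all degrees) and a linear system of parameters for $\mathbb{R}[\Delta]$, and $\Delta$ is Cohen–Macaulay. -/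

import Mathlib

open MvPolynomial

noncomputable section

namespace ToricChordality

variable {n : ℕ}

/-- The constant-coefficient differential operator `p^∨ = p(d/dx)` on `ℝ[x₁, …, xₙ]`: it is linear
in `p`, and the monomial `x^a` is sent to `(d/dx₁)^{a₁} ∘ ⋯ ∘ (d/dxₙ)^{aₙ}`. -/
def diffOp : MvPolynomial (Fin n) ℝ →ₗ[ℝ] Module.End ℝ (MvPolynomial (Fin n) ℝ) :=
  (basisMonomials (Fin n) ℝ).constr ℝ fun a =>
    (List.ofFn fun i : Fin n =>
      ((pderiv i : Derivation ℝ (MvPolynomial (Fin n) ℝ) (MvPolynomial (Fin n) ℝ)).toLinearMap :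
        Module.End ℝ (MvPolynomial (Fin n) ℝ)) ^ a i).prod

/-- The linear form `c₁ x₁ + ⋯ + cₙ xₙ`. -/
def linearForm (c : Fin n → ℝ) : MvPolynomial (Fin n) ℝ := ∑ i, C (c i) * X i

/-- The linear differential `c₁ d/dx₁ + ⋯ + cₙ d/dxₙ`. -/
def linearDifferential (c : Fin n → ℝ) : Module.End ℝ (MvPolynomial (Fin n) ℝ) :=
  diffOp (linearForm c)

theorem diffOp_monomial (a : Fin n →₀ ℕ) :
    diffOp (monomial a (1 : ℝ)) = (List.ofFn fun i : Fin n =>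
      ((pderiv i : Derivation ℝ (MvPolynomial (Fin n) ℝ) (MvPolynomial (Fin n) ℝ)).toLinearMap :
        Module.End ℝ (MvPolynomial (Fin n) ℝ)) ^ a i).prod := by
  have h : (monomial a (1 : ℝ)) = basisMonomials (Fin n) ℝ a := by simp
  rw [h, diffOp, Module.Basis.constr_basis]

theorem prod_ofFn_eq_of_unique {M : Type*} [Monoid M] {m : ℕ} (f : Fin m → M) (i : Fin m)
    (h : ∀ j, j ≠ i → f j = 1) : (List.ofFn f).prod = f i := by
  induction m with
  | zero => exact i.elim0
  | succ m ih =>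
    rw [List.ofFn_succ, List.prod_cons]
    refine Fin.cases (fun h => ?_) (fun i h => ?_) i h
    · rw [List.prod_eq_one, mul_one]
      intro x hx
      obtain ⟨j, rfl⟩ := List.mem_ofFn.1 hx
      exact h _ (Fin.succ_ne_zero j)
    · rw [h 0 (Fin.succ_ne_zero i).symm, one_mul]
      exact ih (fun j => f j.succ) i fun j hj => h _ fun e => hj (Fin.succ_injective _ e)

theorem diffOp_X (i : Fin n) (p : MvPolynomial (Fin n) ℝ) : diffOp (X i) p = pderiv i p := by
  rw [X, diffOp_monomial, prod_ofFn_eq_of_unique _ i]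
  · simp
  · intro j hj
    simp [hj.symm]

theorem linearDifferential_apply (c : Fin n → ℝ) (p : MvPolynomial (Fin n) ℝ) :
    linearDifferential c p = ∑ i, c i • pderiv i p := by
  simp [linearDifferential, linearForm, C_mul', diffOp_X]

/-- The nonface ideal `I_Δ = ⟨x^a : supp a ∉ Δ⟩`. Mathlib's complexes list only the nonempty faces,
the empty set being a face of every complex. -/
def nonfaceIdeal (Δ : PreAbstractSimplicialComplex (Fin n)) : Ideal (MvPolynomial (Fin n) ℝ) :=
  Ideal.span {f | ∃ a : Fin n →₀ ℕ, a.support.Nonempty ∧ a.support ∉ Δ ∧ f = monomial a 1}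

/-- The ideal generated by the linear forms of a sequence. -/
def formsIdeal {l : ℕ} (Θ : Fin l → Fin n → ℝ) : Ideal (MvPolynomial (Fin n) ℝ) :=
  Ideal.span (Set.range fun j => linearForm (Θ j))

/-- The Krull dimension of the Stanley–Reisner ring `ℝ[Δ] = ℝ[x] / I_Δ`. -/
def stanleyReisnerDim (Δ : PreAbstractSimplicialComplex (Fin n)) : WithBot ℕ∞ :=
  ringKrullDim (MvPolynomial (Fin n) ℝ ⧸ nonfaceIdeal Δ)

/-- The stress space of `Δ`, without linear forms: the polynomials that `I_Δ^∨` annihilates. -/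
def freeStressSpace (Δ : PreAbstractSimplicialComplex (Fin n)) :
    Submodule ℝ (MvPolynomial (Fin n) ℝ) :=
  ⨅ f ∈ nonfaceIdeal Δ, LinearMap.ker (diffOp f)

/-- The stress space of `Δ` with respect to the linear forms `Θ`. -/
def stressSpace (Δ : PreAbstractSimplicialComplex (Fin n)) {l : ℕ} (Θ : Fin l → Fin n → ℝ) :
    Submodule ℝ (MvPolynomial (Fin n) ℝ) :=
  freeStressSpace Δ ⊓ ⨅ j, LinearMap.ker (linearDifferential (Θ j))

/-- The degree `i` part of the stress space of `Δ` with respect to `Θ`. -/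
def stress (Δ : PreAbstractSimplicialComplex (Fin n)) {l : ℕ} (Θ : Fin l → Fin n → ℝ) (i : ℕ) :
    Submodule ℝ (MvPolynomial (Fin n) ℝ) :=
  stressSpace Δ Θ ⊓ homogeneousSubmodule (Fin n) ℝ i

/-- The sequence `Θ₁, …, Θ_j`. -/
def truncate {l : ℕ} (Θ : Fin l → Fin n → ℝ) (j : Fin l) : Fin j.val → Fin n → ℝ :=
  fun m => Θ (Fin.castLE j.isLt.le m)

/-- For every `j`, the `j`-th form of `Θ` maps the stresses of degree `i + 1` with respect to the
preceding forms onto those of degree `i`. -/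
def IsRegularAt (Δ : PreAbstractSimplicialComplex (Fin n)) {l : ℕ} (Θ : Fin l → Fin n → ℝ)
    (i : ℕ) : Prop :=
  ∀ j : Fin l, Set.SurjOn (linearDifferential (Θ j))
    (stress Δ (truncate Θ j) (i + 1)) (stress Δ (truncate Θ j) i)

/-- The sequence `Θ` is regular up to degree `k`. -/
def IsRegularUpTo (Δ : PreAbstractSimplicialComplex (Fin n)) {l : ℕ} (Θ : Fin l → Fin n → ℝ)
    (k : ℕ) : Prop :=
  ∀ i ≤ k, IsRegularAt Δ Θ i

/-- The sequence `Θ` is regular. -/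
def IsRegular (Δ : PreAbstractSimplicialComplex (Fin n)) {l : ℕ} (Θ : Fin l → Fin n → ℝ) : Prop :=
  ∀ i, IsRegularAt Δ Θ i

/-- `Θ` is a linear system of parameters: its length `l` is the Krull dimension of `ℝ[Δ]`, and
`dim ℝ[Δ] / Θ ℝ[Δ] = dim ℝ[Δ] - l`, that is, `dim ℝ[Δ] / Θ ℝ[Δ] = 0`. -/
def IsLinearSystemOfParameters (Δ : PreAbstractSimplicialComplex (Fin n)) {l : ℕ}
    (Θ : Fin l → Fin n → ℝ) : Prop :=
  stanleyReisnerDim Δ = (l : WithBot ℕ∞) ∧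
    ringKrullDim (MvPolynomial (Fin n) ℝ ⧸ (nonfaceIdeal Δ ⊔ formsIdeal Θ)) = 0

/-- The depth of `Δ`: the supremum of the lengths of the regular sequences of linear forms. -/
def depth (Δ : PreAbstractSimplicialComplex (Fin n)) : ℕ∞ :=
  ⨆ (l : ℕ) (_ : ∃ Θ : Fin l → Fin n → ℝ, IsRegular Δ Θ), (l : ℕ∞)

/-- `Δ` is Cohen–Macaulay: its depth equals the Krull dimension of its Stanley–Reisner ring. -/
def IsCohenMacaulay (Δ : PreAbstractSimplicialComplex (Fin n)) : Prop :=
  (depth Δ : WithBot ℕ∞) = stanleyReisnerDim Δ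

/-- For the coordinatization by the matrix `V` (the `i`-th column holds the coordinates of the
vertex `i`) and the linear differential with coefficients `w`, the complex `Δ` is toric
`k`-chordal: the differential maps the stresses of degree `k + 1` onto those of degree `k`, and is
injective from degree `k` to degree `k - 1`. For `k = 0` the target of the second map is zero, as
is the differential on constants. -/
def IsToricChordal (Δ : PreAbstractSimplicialComplex (Fin n)) {l : ℕ}
    (V : Matrix (Fin l) (Fin n) ℝ) (w : Fin n → ℝ) (k : ℕ) : Prop :=
  Set.SurjOn (linearDifferential w) (stress Δ V.row (k + 1)) (stress Δ V.row k) ∧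
    Set.InjOn (linearDifferential w) (stress Δ V.row k)

/-- A missing face: a minimal nonface on the vertex set of `Δ`. -/
def IsMissingFace (Δ : PreAbstractSimplicialComplex (Fin n)) (σ : Finset (Fin n)) : Prop :=
  σ.Nonempty ∧ (∀ v ∈ σ, {v} ∈ Δ) ∧ σ ∉ Δ ∧ ∀ τ ⊂ σ, τ.Nonempty → τ ∈ Δ

/-- `Δ` has no missing face of dimension `> k`, where the dimension of `σ` is `#σ - 1`. -/
def NoMissingFacesAbove (Δ : PreAbstractSimplicialComplex (Fin n)) (k : ℕ) : Prop :=
  ∀ σ, IsMissingFace Δ σ → σ.card ≤ k + 1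

/-- The sequence `(V∇, ω)`: the linear forms given by the rows of `V`, followed by the linear form
with coefficients `w`. -/
def extendedSequence {l : ℕ} (V : Matrix (Fin l) (Fin n) ℝ) (w : Fin n → ℝ) :
    Fin (l + 1) → Fin n → ℝ :=
  Fin.snoc (α := fun _ => Fin n → ℝ) V.row w

end ToricChordality

end

noncomputable section

namespace ToricChordality

variable {n : ℕ}

/-! View stresses as coefficients of differential forms on `ℝⁿ`. Injectivity of `ω` leaves no stress
in degree `k` that is killed by all `l + 1` forms, hence none in any degree `≥ k`. Exactness of
closed 2-forms (`ClosedTwoFormsExact`) is therefore trivial for the full sequence, and it is carried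
down by removing one linear form `θ` at a time. If it holds on `S ∩ ker θ`, then surjectivity of `θ`
on `S` passes from degree `e` to `e + 1` (`surjective_of_closedTwoFormsExact`): lift each `∂ₐq`,
correct the lifts to a closed 1-form, and integrate it by the Poincaré lemma. The bound on missing
faces puts the integral back in `S`. Surjectivity in turn gives exactness on `S` by Cartan's formula
(`ClosedTwoFormsExact.of_surjective`), so the induction continues. Macaulay duality turns regularity
into a sequence of nonzerodivisors, so its length is at most `dim ℝ[Δ]`. Vanishing of stresses in
high degrees makes `ℝ[Δ]` finite over the algebra generated by the forms, which gives the opposite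
inequality. -/

theorem pderiv_pderiv_comm (a b : Fin n) (p : MvPolynomial (Fin n) ℝ) :
    pderiv a (pderiv b p) = pderiv b (pderiv a p) := by
  ext m
  simp only [coeff_pderiv, Finsupp.add_apply]
  rw [add_right_comm m]
  by_cases h : a = b
  · subst h; ring
  · rw [Finsupp.single_eq_of_ne h, Finsupp.single_eq_of_ne (Ne.symm h)]
    push_cast; ring

theorem isHomogeneous_pderiv {p : MvPolynomial (Fin n) ℝ} {d : ℕ} (hp : p.IsHomogeneous (d + 1))
    (a : Fin n) : (pderiv a p).IsHomogeneous d := by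
  simpa using hp.pderiv (i := a)

theorem eq_zero_of_pderiv_eq_zero {p : MvPolynomial (Fin n) ℝ} {d : ℕ}
    (hp : p.IsHomogeneous (d + 1)) (h : ∀ a, pderiv a p = 0) : p = 0 := by
  have := hp.sum_X_mul_pderiv
  simp only [h, mul_zero, Finset.sum_const_zero] at this
  have h2 := this.symm
  rwa [smul_eq_zero_iff_right (Nat.succ_ne_zero d)] at h2

/-- The Poincaré lemma for closed `1`-forms with homogeneous coefficients. -/
theorem exists_pderiv_eq_of_closed {p : Fin n → MvPolynomial (Fin n) ℝ} {d : ℕ}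
    (hp : ∀ a, (p a).IsHomogeneous d) (h : ∀ a b, pderiv a (p b) = pderiv b (p a)) :
    ∃ q : MvPolynomial (Fin n) ℝ, q.IsHomogeneous (d + 1) ∧ ∀ a, pderiv a q = p a := by
  -- Contract with the radial field: by closedness and Euler's identity, `∂_b` of the sum is `d • p
  -- b + p b`.
  refine ⟨((d : ℝ) + 1)⁻¹ • ∑ a, X a * p a, ?_, fun b => ?_⟩
  · refine (homogeneousSubmodule (Fin n) ℝ (d + 1)).smul_mem _ (Submodule.sum_mem _ fun a _ => ?_)
    rw [mem_homogeneousSubmodule, add_comm]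
    exact (isHomogeneous_X ℝ a).mul (hp a)
  · have h1 : pderiv b (∑ a, X a * p a) = ((d : ℝ) + 1) • p b := by
      simp only [map_sum, pderiv_mul, Finset.sum_add_distrib, h b]
      rw [(hp b).sum_X_mul_pderiv, Finset.sum_eq_single b]
      · rw [pderiv_X_self, one_mul, add_smul, one_smul, add_comm, Nat.cast_smul_eq_nsmul]
      · intro a _ hab
        rw [pderiv_X_of_ne hab, zero_mul]
      · simp
    rw [Derivation.map_smul, h1, smul_smul, inv_mul_cancel₀ (by positivity), one_smul]

theorem linearDifferential_pderiv (c : Fin n → ℝ) (a : Fin n) (p : MvPolynomial (Fin n) ℝ) :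
    linearDifferential c (pderiv a p) = pderiv a (linearDifferential c p) := by
  simp only [linearDifferential_apply, map_sum, Derivation.map_smul, pderiv_pderiv_comm a]

theorem isHomogeneous_linearDifferential {p : MvPolynomial (Fin n) ℝ} {d : ℕ}
    (hp : p.IsHomogeneous (d + 1)) (c : Fin n → ℝ) :
    (linearDifferential c p).IsHomogeneous d := by
  rw [linearDifferential_apply]
  exact Submodule.sum_mem (homogeneousSubmodule (Fin n) ℝ d) fun a _ =>
    Submodule.smul_mem _ _ (isHomogeneous_pderiv hp a)

/-! ### Exactness of closed 2-forms and surjectivity of linear differentials -/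

/-- Closed `2`-forms with homogeneous coefficients in `S` of degree at least `k` are exterior
derivatives of `1`-forms with coefficients in `S`. -/
def ClosedTwoFormsExact (S : Submodule ℝ (MvPolynomial (Fin n) ℝ)) (k : ℕ) : Prop :=
  ∀ e, k ≤ e → ∀ z : Fin n → Fin n → MvPolynomial (Fin n) ℝ,
    (∀ a b, z a b ∈ S ∧ (z a b).IsHomogeneous e) → (∀ a b, z a b = -z b a) →
    (∀ a b c, pderiv a (z b c) + pderiv b (z c a) + pderiv c (z a b) = 0) →
    ∃ y : Fin n → MvPolynomial (Fin n) ℝ, (∀ a, y a ∈ S ∧ (y a).IsHomogeneous (e + 1)) ∧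
      ∀ a b, z a b = pderiv a (y b) - pderiv b (y a)

theorem closedTwoFormsExact_of_eq_zero {S : Submodule ℝ (MvPolynomial (Fin n) ℝ)} {k : ℕ}
    (h : ∀ e, k ≤ e → ∀ q ∈ S, q.IsHomogeneous e → q = 0) : ClosedTwoFormsExact S k := by
  intro e he z hz _ _
  refine ⟨0, fun a => ⟨S.zero_mem, isHomogeneous_zero _ _ _⟩, fun a b => ?_⟩
  simpa using h e he _ (hz a b).1 (hz a b).2

/-- Cartan's formula for the Lie derivative of a closed `2`-form along a constant vector field. -/
theorem linearDifferential_eq_of_closed (c : Fin n → ℝ)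
    {z : Fin n → Fin n → MvPolynomial (Fin n) ℝ} (hz : ∀ a b, z a b = -z b a)
    (hc : ∀ a b c, pderiv a (z b c) + pderiv b (z c a) + pderiv c (z a b) = 0) (a b : Fin n) :
    linearDifferential c (z a b) =
      pderiv a (∑ i, c i • z i b) - pderiv b (∑ i, c i • z i a) := by
  simp only [linearDifferential_apply, map_sum, Derivation.map_smul, ← Finset.sum_sub_distrib,
    ← smul_sub]
  refine Finset.sum_congr rfl fun i _ => ?_
  congr 1
  have h := hc i a b
  rw [hz b i, map_neg] at h
  linear_combination h

/-- By Cartan's formula the derivative of `z` along `c` is `d(ι_c z)`. Lifting `ι_c z` through `c`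
to a 1-form `y` makes `z - dy` a closed form killed by `c`, where exactness is already known. -/
theorem ClosedTwoFormsExact.of_surjective {S : Submodule ℝ (MvPolynomial (Fin n) ℝ)} {k : ℕ}
    {c : Fin n → ℝ}
    (hsurj : ∀ e, k ≤ e → ∀ q ∈ S, q.IsHomogeneous e →
      ∃ p ∈ S, p.IsHomogeneous (e + 1) ∧ linearDifferential c p = q)
    (hS : ClosedTwoFormsExact (S ⊓ LinearMap.ker (linearDifferential c)) k)
    (hder : ∀ a, ∀ q ∈ S, pderiv a q ∈ S) :
    ClosedTwoFormsExact S k := by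
  intro e he z hz hanti hclosed
  have hι (b : Fin n) : ∃ p ∈ S, p.IsHomogeneous (e + 1) ∧
      linearDifferential c p = ∑ i, c i • z i b :=
    hsurj e he _ (Submodule.sum_mem _ fun i _ => S.smul_mem _ (hz i b).1)
      (Submodule.sum_mem (homogeneousSubmodule (Fin n) ℝ e) fun i _ =>
        Submodule.smul_mem _ _ (hz i b).2)
  choose y hyS hyh hy using hι
  obtain ⟨y', hy', h'⟩ := hS e he (fun a b => z a b - (pderiv a (y b) - pderiv b (y a)))
    (fun a b => ⟨⟨S.sub_mem (hz a b).1 (S.sub_mem (hder _ _ (hyS b)) (hder _ _ (hyS a))), by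
        rw [SetLike.mem_coe, LinearMap.mem_ker, map_sub, map_sub, linearDifferential_pderiv,
          linearDifferential_pderiv, hy, hy, linearDifferential_eq_of_closed c hanti hclosed,
          sub_self]⟩,
      (hz a b).2.sub ((isHomogeneous_pderiv (hyh b) a).sub (isHomogeneous_pderiv (hyh a) b))⟩)
    (fun a b => by rw [hanti a b]; ring)
    (fun a b d => by
      simp only [map_sub]
      rw [pderiv_pderiv_comm a b, pderiv_pderiv_comm d a, pderiv_pderiv_comm b d]
      linear_combination hclosed a b d)
  refine ⟨fun a => y a + y' a, fun a => ⟨S.add_mem (hyS a) (hy' a).1.1,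
    (hyh a).add (hy' a).2⟩, fun a b => ?_⟩
  rw [map_add, map_add]
  linear_combination h' a b

/-- The lifts `p a` of `∂ₐq` need not form a closed 1-form, but `dp` is killed by `c` since `∂ₐ∂_b
q` is symmetric. Hence `dp = dy` with `y` killed by `c`, and `p - y` is a closed lift. -/
theorem surjective_of_closedTwoFormsExact {S : Submodule ℝ (MvPolynomial (Fin n) ℝ)} {k : ℕ}
    {c : Fin n → ℝ} (hder : ∀ a, ∀ q ∈ S, pderiv a q ∈ S)
    (hdet : ∀ e, k + 1 ≤ e → ∀ q : MvPolynomial (Fin n) ℝ, q.IsHomogeneous (e + 1) →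
      (∀ a, pderiv a q ∈ S) → q ∈ S)
    (hS : ClosedTwoFormsExact (S ⊓ LinearMap.ker (linearDifferential c)) k)
    (hk : ∀ q ∈ S, q.IsHomogeneous k →
      ∃ p ∈ S, p.IsHomogeneous (k + 1) ∧ linearDifferential c p = q)
    (e : ℕ) (he : k ≤ e) : ∀ q ∈ S, q.IsHomogeneous e →
      ∃ p ∈ S, p.IsHomogeneous (e + 1) ∧ linearDifferential c p = q := by
  induction e, he using Nat.le_induction with
  | base => exact hk
  | succ e he ih =>
    intro q hq hqh
    choose p hpS hph hp using fun a => ih (pderiv a q) (hder a q hq) (isHomogeneous_pderiv hqh a)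
    obtain ⟨y, hy, h⟩ := hS e he (fun a b => pderiv a (p b) - pderiv b (p a))
      (fun a b => ⟨⟨S.sub_mem (hder _ _ (hpS b)) (hder _ _ (hpS a)), by
        rw [SetLike.mem_coe, LinearMap.mem_ker, map_sub, linearDifferential_pderiv,
          linearDifferential_pderiv, hp, hp, pderiv_pderiv_comm, sub_self]⟩,
        (isHomogeneous_pderiv (hph b) a).sub (isHomogeneous_pderiv (hph a) b)⟩)
      (fun a b => by ring)
      (fun a b d => by
        simp only [map_sub]
        rw [pderiv_pderiv_comm a b, pderiv_pderiv_comm d a, pderiv_pderiv_comm b d]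
        ring)
    obtain ⟨r, hr, hrd⟩ := exists_pderiv_eq_of_closed (p := fun a => p a - y a)
      (fun a => (hph a).sub (hy a).2) (fun a b => by
        rw [map_sub, map_sub]
        linear_combination h a b)
    -- The degree of `r` is `e + 2 ≥ k + 2`, the least degree `hdet` admits. The image of `r` and
    -- `q` have positive degree and equal derivatives, so they agree.
    refine ⟨r, hdet _ (by omega) r hr fun a => hrd a ▸ S.sub_mem (hpS a) (hy a).1.1, hr, ?_⟩
    rw [← sub_eq_zero]
    refine eq_zero_of_pderiv_eq_zero (d := e)
      ((isHomogeneous_linearDifferential hr c).sub hqh) fun a => ?_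
    rw [map_sub, ← linearDifferential_pderiv, hrd, map_sub, hp, LinearMap.mem_ker.1 (hy a).1.2,
      sub_zero, sub_self]

/-! ### Differential operators and Macaulay duality -/

/-- The product of the factorials of the exponents of a monomial. -/
def expFactorial (m : Fin n →₀ ℕ) : ℝ := ∏ i, ((m i).factorial : ℝ)

theorem expFactorial_ne_zero (m : Fin n →₀ ℕ) : expFactorial m ≠ 0 :=
  Finset.prod_ne_zero_iff.2 fun i _ => by positivity

theorem expFactorial_add_single (m : Fin n →₀ ℕ) (i : Fin n) :
    expFactorial (m + Finsupp.single i 1) = (m i + 1) * expFactorial m := by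
  unfold expFactorial
  rw [← Finset.mul_prod_erase _ _ (Finset.mem_univ i),
    ← Finset.mul_prod_erase Finset.univ (fun j => ((m j).factorial : ℝ)) (Finset.mem_univ i),
    ← mul_assoc]
  congr 1
  · simp [Nat.factorial_succ]
  · refine Finset.prod_congr rfl fun j hj => ?_
    simp [Finsupp.single_eq_of_ne (Finset.ne_of_mem_erase hj)]

theorem prod_ofFn_mul_of_commute {M : Type*} [Monoid M] {m : ℕ} (f g : Fin m → M)
    (h : ∀ i j, Commute (f i) (g j)) :
    (List.ofFn fun i => f i * g i).prod = (List.ofFn f).prod * (List.ofFn g).prod := by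
  induction m with
  | zero => simp
  | succ m ih =>
    simp only [List.ofFn_succ, List.prod_cons]
    rw [ih _ _ fun i j => h i.succ j.succ]
    have hc : Commute (List.ofFn fun i : Fin m => f i.succ).prod (g 0) := by
      refine Commute.list_prod_left _ _ fun x hx => ?_
      obtain ⟨j, rfl⟩ := List.mem_ofFn.1 hx
      exact h _ _
    simp only [mul_assoc, hc.left_comm]

theorem diffOp_one : diffOp (1 : MvPolynomial (Fin n) ℝ) = 1 := by
  rw [← C_1, ← monomial_zero', diffOp_monomial]
  simp

theorem diffOp_monomial_add (a b : Fin n →₀ ℕ) :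
    diffOp (monomial (a + b) (1 : ℝ)) = diffOp (monomial a 1) * diffOp (monomial b 1) := by
  rw [diffOp_monomial, diffOp_monomial, diffOp_monomial, ← prod_ofFn_mul_of_commute]
  · simp only [Finsupp.add_apply, pow_add]
  · refine fun i j => Commute.pow_pow (LinearMap.ext fun p => ?_) _ _
    exact pderiv_pderiv_comm i j p

theorem monomial_eq_smul (a : Fin n →₀ ℕ) (c : ℝ) :
    monomial a c = c • monomial a (1 : ℝ) := by
  rw [smul_monomial, smul_eq_mul, mul_one]

theorem diffOp_mul (p q : MvPolynomial (Fin n) ℝ) : diffOp (p * q) = diffOp p * diffOp q := by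
  induction p using MvPolynomial.induction_on' with
  | add p₁ p₂ h₁ h₂ => rw [add_mul, map_add, map_add, add_mul, h₁, h₂]
  | monomial a c =>
    induction q using MvPolynomial.induction_on' with
    | add p₁ p₂ h₁ h₂ => rw [mul_add, map_add, map_add, mul_add, h₁, h₂]
    | monomial b d =>
      rw [monomial_mul, monomial_eq_smul, monomial_eq_smul a, monomial_eq_smul b]
      simp only [map_smul, diffOp_monomial_add, smul_mul_smul_comm]

/-- Once coefficients are rescaled by factorials (divided powers), differentiation is a shift of
exponents. -/
theorem coeff_diffOp_monomial (a : Fin n →₀ ℕ) (q : MvPolynomial (Fin n) ℝ) (m : Fin n →₀ ℕ) :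
    coeff m (diffOp (monomial a 1) q) * expFactorial m =
      coeff (m + a) q * expFactorial (m + a) := by
  induction a using Finsupp.induction_linear generalizing q m with
  | zero =>
    simp [diffOp_one]
  | add a b ha hb =>
    rw [diffOp_monomial_add, Module.End.mul_apply, ha, hb, add_assoc]
  | single i r =>
    induction r generalizing q m with
    | zero =>
      simp [diffOp_one]
    | succ r ih =>
      rw [Finsupp.single_add, diffOp_monomial_add, Module.End.mul_apply, ih, ← X, diffOp_X,
        coeff_pderiv, ← add_assoc, expFactorial_add_single]
      ring

/-- A polynomial on which the polynomials of degree `e` act by a prescribed functional. -/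
theorem exists_coeff_diffOp_eq (φ : MvPolynomial (Fin n) ℝ →ₗ[ℝ] ℝ) (e : ℕ) :
    ∃ q : MvPolynomial (Fin n) ℝ, q.IsHomogeneous e ∧ ∀ p m,
      coeff m (diffOp p q) * expFactorial m =
        φ (homogeneousComponent e (monomial m 1 * p)) := by
  have hfin : {m : Fin n →₀ ℕ | m.degree = e}.Finite := 
    (Finsupp.finite_of_degree_le e).subset fun _ h => le_of_eq h
  refine ⟨∑ m ∈ hfin.toFinset, monomial m (φ (monomial m 1) / expFactorial m), ?_, ?_⟩
  · exact Submodule.sum_mem (homogeneousSubmodule (Fin n) ℝ e) fun m hm =>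
      isHomogeneous_monomial _ (by simpa using hm)
  · intro p m
    induction p using MvPolynomial.induction_on' with
    | add p₁ p₂ h₁ h₂ =>
      rw [map_add, LinearMap.add_apply, coeff_add, add_mul, h₁, h₂, mul_add, map_add, map_add]
    | monomial a c =>
      rw [monomial_eq_smul, map_smul, LinearMap.smul_apply, coeff_smul, smul_eq_mul, mul_assoc,
        coeff_diffOp_monomial, mul_smul_comm, map_smul, map_smul, smul_eq_mul, monomial_mul,
        one_mul, coeff_sum]
      congr 1
      simp only [coeff_monomial, Finset.sum_ite_eq', Set.Finite.mem_toFinset, Set.mem_ofPred_eq]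
      split_ifs with h
      · rw [homogeneousComponent_of_mem (isHomogeneous_monomial _ h), if_pos rfl,
          div_mul_cancel₀ _ (expFactorial_ne_zero _)]
      · rw [homogeneousComponent_of_mem (isHomogeneous_monomial _ rfl), if_neg (Ne.symm h)]
        simp

attribute [local instance] MvPolynomial.gradedAlgebra

/-- Macaulay duality: a polynomial outside a homogeneous ideal is detected by a homogeneous element
of the inverse system of the ideal. -/
theorem exists_diffOp_ne_zero {J : Ideal (MvPolynomial (Fin n) ℝ)}
    (hJ : J.IsHomogeneous (homogeneousSubmodule (Fin n) ℝ)) {f : MvPolynomial (Fin n) ℝ}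
    (hf : f ∉ J) : ∃ (e : ℕ) (q : MvPolynomial (Fin n) ℝ), q.IsHomogeneous e ∧
      (∀ g ∈ J, diffOp g q = 0) ∧ diffOp f q ≠ 0 := by
  rw [mem_iff_homogeneousComponent_mem hJ, not_forall] at hf
  obtain ⟨e, he⟩ := hf
  -- A functional that vanishes on `J` but not on the degree `e` component of `f`; `q` represents it
  -- in degree `e`, and the constant term of `diffOp f q` is its value there.
  obtain ⟨φ, hφ, hφJ⟩ := (J.restrictScalars ℝ).exists_le_ker_of_notMem he
  obtain ⟨q, hq, hqφ⟩ := exists_coeff_diffOp_eq φ e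
  refine ⟨e, q, hq, fun g hg => ?_, fun h => hφ ?_⟩
  · ext m
    have h : φ (homogeneousComponent e (monomial m 1 * g)) = 0 :=
      hφJ (homogeneousComponent_mem_of_mem hJ (J.mul_mem_left _ hg) e)
    rw [← hqφ] at h
    simpa using (mul_eq_zero.1 h).resolve_right (expFactorial_ne_zero m)
  · have := hqφ f 0
    rw [h, coeff_zero, zero_mul] at this
    simpa using this.symm

theorem homogeneousComponent_succ_mul {p q : MvPolynomial (Fin n) ℝ} (hq : q.IsHomogeneous 1)
    (e : ℕ) : homogeneousComponent (e + 1) (p * q) = homogeneousComponent e p * q := by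
  conv_lhs => rw [← sum_homogeneousComponent p, Finset.sum_mul, map_sum]
  have h (d : ℕ) : homogeneousComponent (e + 1) (homogeneousComponent d p * q) =
      if e = d then homogeneousComponent e p * q else 0 := by
    rw [homogeneousComponent_of_mem ((homogeneousComponent_isHomogeneous d p).mul hq)]
    by_cases hd : e = d
    · simp [hd]
    · simp [hd]
  simp only [h, Finset.sum_ite_eq, Finset.mem_range]
  split_ifs with hd
  · rfl
  · rw [homogeneousComponent_eq_zero _ _ (by omega), zero_mul]

theorem isHomogeneous_linearForm (c : Fin n → ℝ) : (linearForm c).IsHomogeneous 1 :=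
  Submodule.sum_mem (homogeneousSubmodule (Fin n) ℝ 1) fun i _ => isHomogeneous_C_mul_X _ i

/-! ### Stresses and missing faces -/

theorem diffOp_eq_zero_of_mem_span {s : Set (MvPolynomial (Fin n) ℝ)}
    {q : MvPolynomial (Fin n) ℝ} (h : ∀ g ∈ s, diffOp g q = 0) {g : MvPolynomial (Fin n) ℝ}
    (hg : g ∈ Ideal.span s) : diffOp g q = 0 := by
  induction hg using Submodule.span_induction with
  | mem g hg => exact h g hg
  | zero => simp
  | add f g _ _ hf hg => rw [map_add, LinearMap.add_apply, hf, hg, add_zero]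
  | smul f g _ hg => rw [smul_eq_mul, diffOp_mul, Module.End.mul_apply, hg, map_zero]

theorem mem_freeStressSpace_iff_diffOp {Δ : PreAbstractSimplicialComplex (Fin n)}
    {q : MvPolynomial (Fin n) ℝ} :
    q ∈ freeStressSpace Δ ↔ ∀ g ∈ nonfaceIdeal Δ, diffOp g q = 0 := by
  simp [freeStressSpace, Submodule.mem_iInf]

/-- The stresses are the polynomials all of whose monomials are supported on faces. -/
theorem mem_freeStressSpace_iff {Δ : PreAbstractSimplicialComplex (Fin n)}
    {q : MvPolynomial (Fin n) ℝ} :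
    q ∈ freeStressSpace Δ ↔ ∀ m, coeff m q ≠ 0 → m.support.Nonempty → m.support ∈ Δ := by
  rw [mem_freeStressSpace_iff_diffOp]
  constructor
  · intro h m hm hne
    by_contra hΔ
    have h0 := coeff_diffOp_monomial m q 0
    rw [h _ (Ideal.subset_span ⟨m, hne, hΔ, rfl⟩), coeff_zero, zero_mul, zero_add] at h0
    exact mul_ne_zero hm (expFactorial_ne_zero m) h0.symm
  · intro h g hg
    refine diffOp_eq_zero_of_mem_span ?_ hg
    rintro _ ⟨a, ha, haΔ, rfl⟩
    ext m
    have h0 := coeff_diffOp_monomial a q m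
    suffices hz : coeff (m + a) q = 0 by
      rw [hz, zero_mul] at h0
      exact (mul_eq_zero.1 h0).resolve_right (expFactorial_ne_zero m)
    by_contra hne
    have hsub : a.support ⊆ (m + a).support := fun i hi => by
      simp only [Finsupp.mem_support_iff, Finsupp.add_apply] at hi ⊢
      omega
    exact haΔ ((Δ.isRelLowerSet_faces (h _ hne (ha.mono hsub))).2 hsub ha)

theorem pderiv_mem_freeStressSpace {Δ : PreAbstractSimplicialComplex (Fin n)} (a : Fin n)
    {q : MvPolynomial (Fin n) ℝ} (hq : q ∈ freeStressSpace Δ) :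
    pderiv a q ∈ freeStressSpace Δ := by
  rw [mem_freeStressSpace_iff_diffOp] at hq ⊢
  intro g hg
  rw [← diffOp_X, ← Module.End.mul_apply, ← diffOp_mul]
  exact hq _ (Ideal.mul_mem_right _ _ hg)

/-- If the missing faces have dimension at most `k`, being a stress is detected by the derivatives
in degrees above `k + 1`. -/
theorem mem_freeStressSpace_of_pderiv_mem {Δ : PreAbstractSimplicialComplex (Fin n)} {k e : ℕ}
    (hΔ : NoMissingFacesAbove Δ k) (he : k + 1 ≤ e) {q : MvPolynomial (Fin n) ℝ}
    (hq : q.IsHomogeneous (e + 1)) (h : ∀ a, pderiv a q ∈ freeStressSpace Δ) :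
    q ∈ freeStressSpace Δ := by
  rw [mem_freeStressSpace_iff]
  intro m hm hne
  by_contra hmΔ
  have hdeg : m.degree = e + 1 := by
    by_contra hd
    exact hm (hq.coeff_eq_zero hd)
  have key (a : Fin n) (ha : a ∈ m.support)
      (hs : (m - Finsupp.single a 1).support.Nonempty) :
      (m - Finsupp.single a 1).support ∈ Δ := by
    refine mem_freeStressSpace_iff.1 (h a) _ ?_ hs
    have hle : Finsupp.single a 1 ≤ m := by
      rw [Finsupp.single_le_iff]
      exact Nat.one_le_iff_ne_zero.2 (Finsupp.mem_support_iff.1 ha)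
    rw [coeff_pderiv, tsub_add_cancel_of_le hle]
    exact mul_ne_zero hm (by positivity)
  -- An exponent at least 2 could be lowered without changing the support, which would then be a
  -- face.
  have hone (a : Fin n) (ha : a ∈ m.support) : m a = 1 := by
    by_contra h1
    have hs : (m - Finsupp.single a 1).support = m.support := by
      ext i
      simp only [Finsupp.mem_support_iff, Finsupp.tsub_apply] at ha ⊢
      by_cases hi : a = i
      · subst hi; simp only [Finsupp.single_eq_same]; omega
      · simp [Finsupp.single_eq_of_ne (Ne.symm hi)]
    exact hmΔ (hs ▸ key a ha (hs ▸ hne))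
  have hcard : m.support.card = e + 1 := by
    rw [← hdeg, Finsupp.degree_apply, Finset.sum_congr rfl hone, Finset.card_eq_sum_ones]
  have herase (a : Fin n) (ha : a ∈ m.support) : m.support.erase a ∈ Δ := by
    have hs : (m - Finsupp.single a 1).support = m.support.erase a := by
      ext i
      simp only [Finsupp.mem_support_iff, Finsupp.tsub_apply, Finset.mem_erase]
      by_cases hi : a = i
      · subst hi; simp [hone a ha]
      · simp [Finsupp.single_eq_of_ne (Ne.symm hi), Ne.symm hi]
    refine hs ▸ key a ha (hs ▸ ?_)
    rw [← Finset.card_pos, Finset.card_erase_of_mem ha]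
    omega
  -- With `m` squarefree, all proper nonempty subsets of its support are faces, so the support is a
  -- missing face with `e + 1 ≥ k + 2` vertices.
  have hproper (τ : Finset (Fin n)) (hτ : τ ⊂ m.support) (hτne : τ.Nonempty) : τ ∈ Δ := by
    obtain ⟨a, ha, haτ⟩ := Finset.exists_of_ssubset hτ
    exact (Δ.isRelLowerSet_faces (herase a ha)).2
      (Finset.subset_erase.2 ⟨hτ.1, haτ⟩) hτne
  have := hΔ m.support ⟨hne, fun v hv => hproper _
    ((Finset.singleton_subset_iff.2 hv).ssubset_of_ne fun hv' => by
      have := congrArg Finset.card hv'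
      rw [Finset.card_singleton] at this
      omega) (Finset.singleton_nonempty v), hmΔ, hproper⟩
  omega

/-! ### Propagation of regularity -/

/-- The stresses with respect to the first `j` forms of a sequence. -/
def truncatedStress (Δ : PreAbstractSimplicialComplex (Fin n)) {m : ℕ} (Θ : Fin m → Fin n → ℝ)
    (j : ℕ) : Submodule ℝ (MvPolynomial (Fin n) ℝ) :=
  freeStressSpace Δ ⊓ ⨅ (i : Fin m) (_ : i.val < j), LinearMap.ker (linearDifferential (Θ i))

variable {Δ : PreAbstractSimplicialComplex (Fin n)} {m : ℕ} {Θ : Fin m → Fin n → ℝ}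

theorem mem_truncatedStress {j : ℕ} {q : MvPolynomial (Fin n) ℝ} :
    q ∈ truncatedStress Δ Θ j ↔ q ∈ freeStressSpace Δ ∧
      ∀ i : Fin m, i.val < j → linearDifferential (Θ i) q = 0 := by
  simp [truncatedStress, Submodule.mem_iInf]

theorem stressSpace_truncate (j : Fin m) :
    stressSpace Δ (truncate Θ j) = truncatedStress Δ Θ j := by
  ext q
  simp only [stressSpace, Submodule.mem_inf, Submodule.mem_iInf, LinearMap.mem_ker,
    mem_truncatedStress, truncate]
  exact and_congr_right fun _ => ⟨fun h i hi => h ⟨i, hi⟩, fun h i => h _ i.isLt⟩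

theorem mem_stress_truncate {j : Fin m} {e : ℕ} {q : MvPolynomial (Fin n) ℝ} :
    q ∈ stress Δ (truncate Θ j) e ↔ q ∈ truncatedStress Δ Θ j ∧ q.IsHomogeneous e := by
  rw [stress, stressSpace_truncate, Submodule.mem_inf, mem_homogeneousSubmodule]

theorem truncatedStress_succ (j : Fin m) : truncatedStress Δ Θ (j + 1) =
    truncatedStress Δ Θ j ⊓ LinearMap.ker (linearDifferential (Θ j)) := by
  ext q
  simp only [Submodule.mem_inf, mem_truncatedStress, LinearMap.mem_ker, and_assoc]
  refine and_congr_right fun _ => ⟨fun h => ⟨fun i hi => h i (by omega), h j (by omega)⟩, ?_⟩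
  rintro ⟨h, hj⟩ i hi
  rcases Nat.lt_succ_iff_lt_or_eq.1 hi with hi | hi
  · exact h i hi
  · rwa [Fin.ext hi]

theorem pderiv_mem_truncatedStress {j : ℕ} (a : Fin n) {q : MvPolynomial (Fin n) ℝ}
    (hq : q ∈ truncatedStress Δ Θ j) : pderiv a q ∈ truncatedStress Δ Θ j := by
  rw [mem_truncatedStress] at hq ⊢
  exact ⟨pderiv_mem_freeStressSpace a hq.1, fun i hi => by
    rw [linearDifferential_pderiv, hq.2 i hi, map_zero]⟩

theorem mem_truncatedStress_of_pderiv_mem {k e j : ℕ} (hΔ : NoMissingFacesAbove Δ k)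
    (he : k + 1 ≤ e) {q : MvPolynomial (Fin n) ℝ} (hq : q.IsHomogeneous (e + 1))
    (h : ∀ a, pderiv a q ∈ truncatedStress Δ Θ j) : q ∈ truncatedStress Δ Θ j := by
  rw [mem_truncatedStress]
  refine ⟨mem_freeStressSpace_of_pderiv_mem hΔ he hq fun a => (mem_truncatedStress.1 (h a)).1,
    fun i hi => ?_⟩
  obtain ⟨d, rfl⟩ : ∃ d, e = d + 1 := ⟨e - 1, by omega⟩
  refine eq_zero_of_pderiv_eq_zero (isHomogeneous_linearDifferential hq _) fun a => ?_
  rw [← linearDifferential_pderiv]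
  exact (mem_truncatedStress.1 (h a)).2 i hi

/-- Derivatives of stresses are stresses, and a form of positive degree with zero derivatives is
zero. -/
theorem truncatedStress_eq_zero_of_le {j k e : ℕ}
    (h : ∀ q ∈ truncatedStress Δ Θ j, q.IsHomogeneous k → q = 0) (he : k ≤ e) :
    ∀ q ∈ truncatedStress Δ Θ j, q.IsHomogeneous e → q = 0 := by
  induction e, he using Nat.le_induction with
  | base => exact h
  | succ e he ih =>
    exact fun q hq hqh => eq_zero_of_pderiv_eq_zero hqh fun a =>
      ih _ (pderiv_mem_truncatedStress a hq) (isHomogeneous_pderiv hqh a)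

theorem isRegularAt_iff {e : ℕ} : IsRegularAt Δ Θ e ↔ ∀ j : Fin m, ∀ q ∈ truncatedStress Δ Θ j,
    q.IsHomogeneous e → ∃ p ∈ truncatedStress Δ Θ j, p.IsHomogeneous (e + 1) ∧
      linearDifferential (Θ j) p = q := by
  refine forall_congr' fun j => ⟨fun h q hq hqh => ?_, fun h q hq => ?_⟩
  · obtain ⟨p, hp, rfl⟩ := h (mem_stress_truncate.2 ⟨hq, hqh⟩)
    obtain ⟨hp, hph⟩ := mem_stress_truncate.1 hp
    exact ⟨p, hp, hph, rfl⟩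
  · obtain ⟨hq, hqh⟩ := mem_stress_truncate.1 hq
    obtain ⟨p, hp, hph, rfl⟩ := h q hq hqh
    exact ⟨p, mem_stress_truncate.2 ⟨hp, hph⟩, rfl⟩

/-- Regularity up to degree `k` propagates to all degrees when the missing faces have dimension at
most `k` and no stresses with respect to the whole sequence are left in degree `k`. -/
theorem isRegular_of_isRegularUpTo {k : ℕ} (hΔ : NoMissingFacesAbove Δ k)
    (hreg : IsRegularUpTo Δ Θ k)
    (hzero : ∀ q ∈ truncatedStress Δ Θ m, q.IsHomogeneous k → q = 0) : IsRegular Δ Θ := by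
  have hsurj (j : Fin m) (h : ClosedTwoFormsExact (truncatedStress Δ Θ (j + 1)) k) :=
    surjective_of_closedTwoFormsExact (fun a q hq => pderiv_mem_truncatedStress a hq)
      (fun e he q hq h => mem_truncatedStress_of_pderiv_mem hΔ he hq h)
      (truncatedStress_succ j ▸ h) (isRegularAt_iff.1 (hreg k le_rfl) j)
  -- Descending induction from the full sequence, where all coefficients vanish.
  have hexact (j : ℕ) (hj : j ≤ m) : ClosedTwoFormsExact (truncatedStress Δ Θ j) k := by
    induction hj using Nat.decreasingInduction with
    | self => exact closedTwoFormsExact_of_eq_zero fun e he =>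
        truncatedStress_eq_zero_of_le hzero he
    | of_succ j hj ih =>
      exact ClosedTwoFormsExact.of_surjective (hsurj ⟨j, hj⟩ ih)
        (truncatedStress_succ (Δ := Δ) (Θ := Θ) ⟨j, hj⟩ ▸ ih)
        (fun a q hq => pderiv_mem_truncatedStress a hq)
  intro e
  rcases le_total e k with he | he
  · exact hreg e he
  · exact isRegularAt_iff.2 fun j => hsurj j (hexact _ j.isLt) e he

/-! ### Regular sequences in the Stanley–Reisner ring -/

/-- The generators of the nonface ideal together with the first `j` linear forms of a sequence. -/
def truncatedGenerators (Δ : PreAbstractSimplicialComplex (Fin n)) {m : ℕ} (Θ : Fin m → Fin n → ℝ)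
    (j : ℕ) : Set (MvPolynomial (Fin n) ℝ) :=
  {f | ∃ a : Fin n →₀ ℕ, a.support.Nonempty ∧ a.support ∉ Δ ∧ f = monomial a 1} ∪
    Set.image (fun i => linearForm (Θ i)) {i : Fin m | i.val < j}

/-- The ideal generated by the nonface ideal and the first `j` linear forms of a sequence. -/
def truncatedIdeal (Δ : PreAbstractSimplicialComplex (Fin n)) {m : ℕ} (Θ : Fin m → Fin n → ℝ)
    (j : ℕ) : Ideal (MvPolynomial (Fin n) ℝ) :=
  Ideal.span (truncatedGenerators Δ Θ j)

theorem truncatedIdeal_zero : truncatedIdeal Δ Θ 0 = nonfaceIdeal Δ := by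
  simp [truncatedIdeal, truncatedGenerators, nonfaceIdeal]

theorem truncatedIdeal_length : truncatedIdeal Δ Θ m = nonfaceIdeal Δ ⊔ formsIdeal Θ := by
  have h : {i : Fin m | i.val < m} = Set.univ := Set.eq_univ_of_forall fun i => i.isLt
  rw [truncatedIdeal, truncatedGenerators, Ideal.span_union, h, Set.image_univ]
  rfl

theorem truncatedIdeal_mono {i j : ℕ} (h : i ≤ j) : truncatedIdeal Δ Θ i ≤ truncatedIdeal Δ Θ j :=
  Ideal.span_mono (Set.union_subset_union_right _
    (Set.image_mono fun _ hi => lt_of_lt_of_le hi h))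

theorem linearForm_mem_truncatedIdeal (i : Fin m) {j : ℕ} (h : i.val < j) :
    linearForm (Θ i) ∈ truncatedIdeal Δ Θ j :=
  Ideal.subset_span (Or.inr ⟨i, h, rfl⟩)

theorem isHomogeneous_truncatedIdeal (j : ℕ) :
    (truncatedIdeal Δ Θ j).IsHomogeneous (homogeneousSubmodule (Fin n) ℝ) := by
  refine Ideal.homogeneous_span _ _ ?_
  rintro _ (⟨a, _, _, rfl⟩ | ⟨i, _, rfl⟩)
  · exact ⟨_, isHomogeneous_monomial _ rfl⟩
  · exact ⟨1, isHomogeneous_linearForm _⟩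

theorem isHomogeneous_nonfaceIdeal :
    (nonfaceIdeal Δ).IsHomogeneous (homogeneousSubmodule (Fin n) ℝ) :=
  truncatedIdeal_zero (Δ := Δ) (Θ := Fin.elim0) ▸ isHomogeneous_truncatedIdeal 0

theorem truncatedIdeal_le_ker_constantCoeff (j : ℕ) :
    truncatedIdeal Δ Θ j ≤ RingHom.ker (constantCoeff : MvPolynomial (Fin n) ℝ →+* ℝ) := by
  refine Ideal.span_le.2 ?_
  rintro _ (⟨a, ha, _, rfl⟩ | ⟨i, _, rfl⟩)
  · have : a ≠ 0 := fun h => by simp [h] at ha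
    simp [constantCoeff_eq, coeff_monomial, this]
  · exact (isHomogeneous_linearForm _).coeff_eq_zero (by simp)

theorem truncatedIdeal_ne_top (j : ℕ) : truncatedIdeal Δ Θ j ≠ ⊤ := fun h =>
  RingHom.ker_ne_top _ (top_le_iff.1 (h ▸ truncatedIdeal_le_ker_constantCoeff j))

theorem mem_truncatedStress_iff_diffOp {j : ℕ} {q : MvPolynomial (Fin n) ℝ} :
    q ∈ truncatedStress Δ Θ j ↔ ∀ g ∈ truncatedIdeal Δ Θ j, diffOp g q = 0 := by
  rw [mem_truncatedStress, mem_freeStressSpace_iff_diffOp]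
  constructor
  · rintro ⟨h, hΘ⟩ g hg
    refine diffOp_eq_zero_of_mem_span ?_ hg
    rintro f (hf | ⟨i, hi, rfl⟩)
    · exact h f (Ideal.subset_span hf)
    · exact hΘ i hi
  · exact fun h => ⟨fun g hg =>
      h g (truncatedIdeal_mono (Nat.zero_le j) (truncatedIdeal_zero ▸ hg)),
      fun i hi => h _ (linearForm_mem_truncatedIdeal i hi)⟩

/-- Macaulay duality for stresses. -/
theorem mem_truncatedIdeal_of_diffOp_eq_zero {j : ℕ} {f : MvPolynomial (Fin n) ℝ}
    (h : ∀ e, ∀ q ∈ truncatedStress Δ Θ j, q.IsHomogeneous e → diffOp f q = 0) :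
    f ∈ truncatedIdeal Δ Θ j := by
  by_contra hf
  obtain ⟨e, q, hq, hJ, hfq⟩ := exists_diffOp_ne_zero (isHomogeneous_truncatedIdeal j) hf
  exact hfq (h e q (mem_truncatedStress_iff_diffOp.2 hJ) hq)

/-- If `f * θ` lies in the ideal and `q = θ^∨ p` for a stress `p`, then `f^∨ q = (f * θ)^∨ p = 0`;
duality puts `f` in the ideal. -/
theorem linearForm_mem_nonZeroDivisors (h : IsRegular Δ Θ) (j : Fin m) :
    Ideal.Quotient.mk (truncatedIdeal Δ Θ j) (linearForm (Θ j)) ∈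
      nonZeroDivisors (MvPolynomial (Fin n) ℝ ⧸ truncatedIdeal Δ Θ j) := by
  rw [mem_nonZeroDivisors_iff_right]
  intro x hx
  obtain ⟨f, rfl⟩ := Ideal.Quotient.mk_surjective x
  rw [← map_mul, Ideal.Quotient.eq_zero_iff_mem] at hx
  rw [Ideal.Quotient.eq_zero_iff_mem]
  refine mem_truncatedIdeal_of_diffOp_eq_zero fun e q hq hqh => ?_
  obtain ⟨p, hp, _, rfl⟩ := isRegularAt_iff.1 (h e) j q hq hqh
  rw [linearDifferential, ← Module.End.mul_apply, ← diffOp_mul]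
  exact mem_truncatedStress_iff_diffOp.1 hp _ hx

/-- Each nonzerodivisor lowers the dimension by at least one, and the last quotient is nontrivial.
-/
theorem length_le_stanleyReisnerDim (h : IsRegular Δ Θ) :
    (m : WithBot ℕ∞) ≤ stanleyReisnerDim Δ := by
  have key (j : ℕ) (hj : j ≤ m) : ringKrullDim (MvPolynomial (Fin n) ℝ ⧸ truncatedIdeal Δ Θ j) +
      (j : WithBot ℕ∞) ≤ ringKrullDim (MvPolynomial (Fin n) ℝ ⧸ truncatedIdeal Δ Θ 0) := by
    induction j with
    | zero => simp
    | succ j ih =>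
      refine le_trans ?_ (ih (by omega))
      rw [Nat.cast_succ, add_comm (j : WithBot ℕ∞), ← add_assoc]
      gcongr
      refine ringKrullDim_succ_le_of_surjective
        (Ideal.Quotient.factor (truncatedIdeal_mono (Nat.le_succ j)))
        (Ideal.Quotient.factor_surjective _) (linearForm_mem_nonZeroDivisors h ⟨j, hj⟩) ?_
      rw [Ideal.Quotient.factor_mk, Ideal.Quotient.eq_zero_iff_mem]
      exact linearForm_mem_truncatedIdeal ⟨j, hj⟩ (Nat.lt_succ_self j)
  have : Nontrivial (MvPolynomial (Fin n) ℝ ⧸ truncatedIdeal Δ Θ m) :=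
    Ideal.Quotient.nontrivial_iff.2 (truncatedIdeal_ne_top m)
  have hm := key m le_rfl
  rw [truncatedIdeal_zero] at hm
  exact le_trans (le_add_of_nonneg_left ringKrullDim_nonneg_of_nontrivial) hm

/-! ### Vanishing in high degrees and Krull dimension -/

theorem diffOp_monomial_eq_zero_of_lt {a : Fin n →₀ ℕ} {q : MvPolynomial (Fin n) ℝ} {e : ℕ}
    (hq : q.IsHomogeneous e) (h : e < a.degree) : diffOp (monomial a 1) q = 0 := by
  ext b
  have h0 := coeff_diffOp_monomial a q b
  rw [hq.coeff_eq_zero (by rw [map_add]; omega), zero_mul] at h0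
  exact (mul_eq_zero.1 h0).resolve_right (expFactorial_ne_zero b)

theorem monomial_mem_truncatedIdeal {j k : ℕ}
    (h : ∀ q ∈ truncatedStress Δ Θ j, q.IsHomogeneous k → q = 0) {a : Fin n →₀ ℕ}
    (ha : k ≤ a.degree) : monomial a 1 ∈ truncatedIdeal Δ Θ j := by
  refine mem_truncatedIdeal_of_diffOp_eq_zero fun e q hq hqh => ?_
  rcases lt_or_ge e a.degree with he | he
  · exact diffOp_monomial_eq_zero_of_lt hqh he
  · rw [truncatedStress_eq_zero_of_le h (ha.trans he) q hq hqh, map_zero]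

/-- The variables are nilpotent in the quotient, so every prime pulls back to the ideal of the
origin. -/
theorem ringKrullDim_quotient_truncatedIdeal {j k : ℕ}
    (h : ∀ q ∈ truncatedStress Δ Θ j, q.IsHomogeneous k → q = 0) :
    ringKrullDim (MvPolynomial (Fin n) ℝ ⧸ truncatedIdeal Δ Θ j) = 0 := by
  have : Nontrivial (MvPolynomial (Fin n) ℝ ⧸ truncatedIdeal Δ Θ j) :=
    Ideal.Quotient.nontrivial_iff.2 (truncatedIdeal_ne_top j)
  rw [← ringKrullDimZero_iff_ringKrullDim_eq_zero]
  refine Ring.KrullDimLE.mk₀ fun P hP => ?_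
  set φ := Ideal.Quotient.mk (truncatedIdeal Δ Θ j)
  have hX (i : Fin n) : (X i : MvPolynomial (Fin n) ℝ) ∈ P.comap φ := by
    refine hP.mem_of_pow_mem k ?_
    rw [← map_pow, X_pow_eq_monomial, Ideal.Quotient.eq_zero_iff_mem.2
      (monomial_mem_truncatedIdeal h (by simp))]
    exact P.zero_mem
  have hle : RingHom.ker (constantCoeff : MvPolynomial (Fin n) ℝ →+* ℝ) ≤ P.comap φ := by
    have hsub (f : MvPolynomial (Fin n) ℝ) : f - C (constantCoeff f) ∈ P.comap φ := by
      induction f using MvPolynomial.induction_on with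
      | C r => simp
      | add p q hp hq =>
        rw [map_add, map_add, add_sub_add_comm]
        exact Ideal.add_mem _ hp hq
      | mul_X p i _ => simpa using Ideal.mul_mem_left _ p (hX i)
    intro f hf
    simpa [RingHom.mem_ker.1 hf] using hsub f
  have hmax : (RingHom.ker (constantCoeff : MvPolynomial (Fin n) ℝ →+* ℝ)).IsMaximal :=
    RingHom.ker_isMaximal_of_surjective _ fun r => ⟨C r, constantCoeff_C _ r⟩
  have hcomap : (P.comap φ).IsMaximal := by
    rw [← hmax.eq_of_le (Ideal.IsPrime.ne_top (Ideal.comap_isPrime φ P)) hle]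
    exact hmax
  have hsurj : Function.Surjective φ := Ideal.Quotient.mk_surjective
  rw [← Ideal.map_comap_of_surjective φ hsurj P]
  refine (Ideal.map_eq_top_or_isMaximal_of_surjective φ hsurj hcomap).resolve_left ?_
  rw [Ideal.map_comap_of_surjective φ hsurj P]
  exact hP.ne_top

/-- Incomparability: contraction of primes along an integral extension is strictly monotone. -/
theorem ringKrullDim_le_of_isIntegral {A B : Type*} [CommRing A] [CommRing B] [Algebra A B]
    [Algebra.IsIntegral A B] : ringKrullDim B ≤ ringKrullDim A := by
  refine Order.krullDim_le_of_strictMono (PrimeSpectrum.comap (algebraMap A B)) fun P Q h => ?_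
  exact Ideal.IsIntegral.comap_lt_comap h

/-- A quotient of a polynomial ring in which every monomial of large degree is a combination of the
elements `θ` with coefficients of smaller degree is finite over the algebra generated by `θ`. -/
theorem ringKrullDim_le_of_monomial_eq_sum {A : Type*} [CommRing A] [Algebra ℝ A]
    (π : MvPolynomial (Fin n) ℝ →ₐ[ℝ] A) (hπ : Function.Surjective π) (θ : Fin m → A) (k : ℕ)
    (h : ∀ d, k ≤ d → ∀ a : Fin n →₀ ℕ, a.degree = d + 1 →
      ∃ c : Fin m → MvPolynomial (Fin n) ℝ, (∀ i, (c i).IsHomogeneous d) ∧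
        π (monomial a 1) = ∑ i, π (c i) * θ i) :
    ringKrullDim A ≤ m := by
  let _ : Algebra (MvPolynomial (Fin m) ℝ) A :=
    (aeval θ : MvPolynomial (Fin m) ℝ →ₐ[ℝ] A).toRingHom.toAlgebra
  have hX (i : Fin m) (f : A) : f * θ i = (X i : MvPolynomial (Fin m) ℝ) • f := by
    rw [Algebra.smul_def, mul_comm]
    congr 1
    exact (aeval_X θ i).symm
  have hC (c : ℝ) (f : A) : c • f = (C c : MvPolynomial (Fin m) ℝ) • f := by
    rw [Algebra.smul_def, Algebra.smul_def]
    congr 1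
    exact (aeval_C θ c).symm
  let s : Set A := Set.image (fun a => π (monomial a 1)) {a : Fin n →₀ ℕ | a.degree ≤ k}
  let N := Submodule.span (MvPolynomial (Fin m) ℝ) s
  have hpoly (e : ℕ) (hmon : ∀ a : Fin n →₀ ℕ, a.degree = e → π (monomial a 1) ∈ N)
      (f : MvPolynomial (Fin n) ℝ) (hf : f.IsHomogeneous e) : π f ∈ N := by
    rw [f.as_sum, map_sum]
    refine N.sum_mem fun a ha => ?_
    rw [monomial_eq_smul, map_smul, hC]
    refine N.smul_mem _ (hmon a ?_)
    by_contra had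
    exact mem_support_iff.1 ha (hf.coeff_eq_zero had)
  have hN (e : ℕ) : ∀ a : Fin n →₀ ℕ, a.degree = e → π (monomial a 1) ∈ N := by
    induction e using Nat.strong_induction_on with
    | _ e ih =>
      intro a ha
      rcases le_or_gt e k with he | he
      · exact Submodule.subset_span ⟨a, ha.trans_le he, rfl⟩
      obtain ⟨d, rfl⟩ : ∃ d, e = d + 1 := ⟨e - 1, by omega⟩
      obtain ⟨c, hc, hac⟩ := h d (by omega) a ha
      rw [hac]
      refine N.sum_mem fun i _ => ?_
      rw [hX]
      exact N.smul_mem _ (hpoly d (ih d (Nat.lt_succ_self d)) _ (hc i))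
  have hfin : Module.Finite (MvPolynomial (Fin m) ℝ) A := by
    refine ⟨Submodule.fg_def.2 ⟨s, (Finsupp.finite_of_degree_le k).image _, ?_⟩⟩
    refine Submodule.eq_top_iff'.2 fun x => ?_
    obtain ⟨f, rfl⟩ := hπ x
    rw [← sum_homogeneousComponent f, map_sum]
    exact N.sum_mem fun e _ => hpoly e (hN e) _ (homogeneousComponent_isHomogeneous e f)
  refine (ringKrullDim_le_of_isIntegral (A := MvPolynomial (Fin m) ℝ)).trans ?_
  rw [MvPolynomial.ringKrullDim_of_isNoetherianRing, ringKrullDim_eq_zero_of_field, zero_add,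
    Nat.card_fin]

theorem stanleyReisnerDim_le_length {k : ℕ}
    (h : ∀ q ∈ truncatedStress Δ Θ m, q.IsHomogeneous k → q = 0) :
    stanleyReisnerDim Δ ≤ m := by
  refine ringKrullDim_le_of_monomial_eq_sum (Ideal.Quotient.mkₐ ℝ (nonfaceIdeal Δ))
    (Ideal.Quotient.mkₐ_surjective _ _)
    (fun i => Ideal.Quotient.mkₐ ℝ (nonfaceIdeal Δ) (linearForm (Θ i))) k fun d hd a ha => ?_
  have hmem : (monomial a 1 : MvPolynomial (Fin n) ℝ) ∈ nonfaceIdeal Δ ⊔ formsIdeal Θ :=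
    truncatedIdeal_length (Δ := Δ) (Θ := Θ) ▸ monomial_mem_truncatedIdeal h (by omega)
  obtain ⟨g, hg, t, ht, hgt⟩ := Submodule.mem_sup.1 hmem
  obtain ⟨c, rfl⟩ := Ideal.mem_span_range_iff_exists_fun.1 ht
  -- Taking degree `d + 1` parts replaces each coefficient `c i` by its degree `d` part, as the
  -- forms are linear.
  have hcomp := congrArg (homogeneousComponent (d + 1)) hgt
  rw [homogeneousComponent_of_mem (isHomogeneous_monomial _ ha), if_pos rfl, map_add,
    map_sum] at hcomp
  refine ⟨fun i => homogeneousComponent d (c i),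
    fun i => homogeneousComponent_isHomogeneous d _, ?_⟩
  have hg0 : Ideal.Quotient.mkₐ ℝ (nonfaceIdeal Δ) (homogeneousComponent (d + 1) g) = 0 :=
    Ideal.Quotient.eq_zero_iff_mem.2
      (homogeneousComponent_mem_of_mem isHomogeneous_nonfaceIdeal hg _)
  rw [← hcomp, map_add, hg0, zero_add, map_sum]
  simp only [homogeneousComponent_succ_mul (isHomogeneous_linearForm _), map_mul]

theorem isCohenMacaulay_of_isRegular (h : IsRegular Δ Θ)
    (hdim : stanleyReisnerDim Δ = (m : WithBot ℕ∞)) : IsCohenMacaulay Δ := by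
  have hd : depth Δ = m := by
    refine le_antisymm (iSup₂_le fun l hl => ?_) (le_iSup₂_of_le m ⟨Θ, h⟩ le_rfl)
    obtain ⟨Θ', hΘ'⟩ := hl
    have := length_le_stanleyReisnerDim hΘ'
    rw [hdim] at this
    exact_mod_cast this
  rw [IsCohenMacaulay, hd, hdim]
  rfl

end ToricChordality

end

theorem mainTheorem8 {n l : ℕ} (Δ : PreAbstractSimplicialComplex (Fin n))
    (V : Matrix (Fin l) (Fin n) ℝ) (w : Fin n → ℝ) (k : ℕ)
    (hchordal : ToricChordality.IsToricChordal Δ V w k)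
    (hmissing : ToricChordality.NoMissingFacesAbove Δ k)
    (hregular : ToricChordality.IsRegularUpTo Δ (ToricChordality.extendedSequence V w) k) :
    ToricChordality.IsRegular Δ (ToricChordality.extendedSequence V w) ∧
      ToricChordality.IsLinearSystemOfParameters Δ (ToricChordality.extendedSequence V w) ∧
      ToricChordality.IsCohenMacaulay Δ := by
  have hzero : ∀ q ∈ ToricChordality.truncatedStress Δ
      (ToricChordality.extendedSequence V w) (l + 1),
      q.IsHomogeneous k → q = 0 := by
    intro q hq hqh
    obtain ⟨hfree, hΘ⟩ := ToricChordality.mem_truncatedStress.1 hq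
    have hV (j : Fin l) : ToricChordality.linearDifferential (V.row j) q = 0 := by
      simpa [ToricChordality.extendedSequence] using hΘ j.castSucc (by simp)
    have hw : ToricChordality.linearDifferential w q = 0 := by
      simpa [ToricChordality.extendedSequence] using hΘ (Fin.last l) (by simp)
    -- A stress for the whole sequence is a stress for `V` killed by `ω`, hence zero in degree `k`
    -- by injectivity.
    refine hchordal.2 ?_ (Submodule.zero_mem _) (by rw [hw, map_zero])
    exact ⟨⟨hfree, by simpa [Submodule.mem_iInf] using hV⟩, hqh⟩
  have hreg := ToricChordality.isRegular_of_isRegularUpTo hmissing hregular hzero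
  have hdim : ToricChordality.stanleyReisnerDim Δ = ((l + 1 : ℕ) : WithBot ℕ∞) :=
    le_antisymm (ToricChordality.stanleyReisnerDim_le_length hzero)
      (ToricChordality.length_le_stanleyReisnerDim hreg)
  refine ⟨hreg, ⟨hdim, ?_⟩, ToricChordality.isCohenMacaulay_of_isRegular hreg hdim⟩
  rw [← ToricChordality.truncatedIdeal_length]
  exact ToricChordality.ringKrullDim_quotient_truncatedIdeal hzero
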